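/- Let $\Lambda$ be a finitely generated virtually free group, that is, a finitely generated group with a free subgroup of finite index. Then every unitary representation of $\Lambda$ in the class $\mathbf{Mult}(\Lambda)$, and hence every one in the class $\mathbf{Mult}_{\mathrm{irr}}(\Lambda)$, is tempered, i.e. weakly contained in the left regular representation of $\Lambda$ on $\ell^2(\Lambda)$. Here the notions are as follows. *Weak containment.* A unitary representation $(\pi,H)$ of a discrete group $G$ is weakly contained in $(\rho,K)$ if for all $\xi\in H$, all finite $Q\subseteq G$ and all $\varepsilon>0$ there are finitely many $\eta_1,\dots,\eta_n\in K$ with $\bigl|\langle\pi(g)\xi,\xi\rangle-\sum_{i}\langle\rho(g)\eta_i,\eta_i\rangle\bigr|<\varepsilon$ for all $g\in Q$. *Matrix systems.* Let $\Gamma$ be a free group with a finite symmetric set $A$ of free generators (a finite free basis together with the inverses of its elements) and word length $|\cdot|$. A matrix system with inner product $(V_a,H_{ba},B_a)$ consists of complex vector spaces $V_a$ $(a\in A)$, linear maps $H_{ba}:V_a\to V_b$ $(a,b\in A)$ with $H_{ba}=0$ if $ba=e$, and positive semidefinite sesquilinear forms $B_a$ on $V_a$ with $B_a(v,v)=\sum_{b\in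 A}B_b(H_{ba}v,H_{ba}v)$ for all $a\in A$, $v\in V_a$. *Multiplicative representations.* A function $f$ on $\Gamma$ is multiplicative if there is $N\ge 0$ such that, whenever $x=x'a$ is reduced (with $a\in A$) and $|x|\ge N$, one has $f(x)\in V_a$ and $f(xb)=H_{ba}f(x)$ for all $b\in A$ with $ba\neq e$. Let $\mathcal H^\infty$ be the space of multiplicative functions modulo equality outside a finite set, with the (semi-)inner product $$\langle f_1,f_2\rangle=\sum_{|x|=N}\ \sum_{a\in A,\ |xa|=|x|+1}B_a\bigl(f_1(xa),f_2(xa)\bigr),\qquad N\text{ large},$$ let $\mathcal H(V_a,H_{ba},B_a)$ be its Hausdorff completion, and let $(\pi(x)f)(y)=f(x^{-1}y)$. *The classes.* A unitary representation $\rho$ of a finitely generated free group $\Gamma$ on a Hilbert space $H$ is in $\mathbf{Mult}(\Gamma)$ if there are a finite symmetric set $A$ of free generators of $\Gamma$, a matrix system with inner product $(V_a,H_{ba},B_a)$, a dense subspace $M\subseteq H$ and a unitary operator $J:H\to\mathcal H(V_a,H_{ba},B_a)$ that maps $M$ onto the image of $\mathcal H^\infty$ and satisfies $J(\rho(x)m)=\pi(x)(Jm)$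 for all $m\in M$, $x\in\Gamma$. A unitary representation of $\Lambda$ is in $\mathbf{Mult}(\Lambda)$ if it is equivalent to a subrepresentation of $\operatorname{Ind}_\Gamma^\Lambda(\pi')$ for some free subgroup $\Gamma\le\Lambda$ of finite index and some $\pi'\in\mathbf{Mult}(\Gamma)$. It is in $\mathbf{Mult}_{\mathrm{irr}}(\Lambda)$ if it is moreover irreducible. Here $\operatorname{Ind}_\Gamma^\Lambda(\pi')$ acts by left translation on the space of functions $f$ on $\Lambda$ with $\pi'(\gamma_0)f(\gamma)=f(\gamma\gamma_0^{-1})$ for $\gamma_0\in\Gamma$, $\gamma\in\Lambda$, with $\langle f,f'\rangle=\sum_{u\in\Lambda/\Gamma}\langle f(u),f'(u)\rangle$. -/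

import Mathlib

open scoped ComplexOrder ComplexConjugate

universe u v w x

namespace VFree


/-! ### Unitary representations -/

section Unitary

variable {G : Type*} [Group G]
variable {H : Type*} [NormedAddCommGroup H] [InnerProductSpace ℂ H]
variable {K : Type*} [NormedAddCommGroup K] [InnerProductSpace ℂ K]

/-- `π` is weakly contained in `ρ`: every diagonal matrix coefficient of `π` is a limit, uniformly
on the compact (that is, finite) subsets of the discrete group `G`, of finite sums of diagonal
matrix coefficients of `ρ`. A unitary representation on `H` is a homomorphism into the group
`H ≃ₗᵢ[ℂ] H` of unitary operators of `H`. -/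
def WeaklyContained (π : G →* (H ≃ₗᵢ[ℂ] H)) (ρ : G →* (K ≃ₗᵢ[ℂ] K)) : Prop :=
  ∀ (ξ : H) (Q : Finset G) (ε : ℝ), 0 < ε →
    ∃ (n : ℕ) (η : Fin n → K), ∀ g ∈ Q,
      ‖inner ℂ ξ (π g ξ) - ∑ i, inner ℂ (η i) (ρ g (η i))‖ < ε

/-- `π` is (unitarily equivalent to) a subrepresentation of `ρ`. -/
def IsSubrep (π : G →* (H ≃ₗᵢ[ℂ] H)) (ρ : G →* (K ≃ₗᵢ[ℂ] K)) : Prop :=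
  ∃ T : H →ₗᵢ[ℂ] K, ∀ (g : G) (v : H), T (π g v) = ρ g (T v)

/-- A unitary representation is irreducible if it is nonzero and has no closed invariant
subspaces besides `0` and the whole space. -/
def IsIrred (π : G →* (H ≃ₗᵢ[ℂ] H)) : Prop :=
  Nontrivial H ∧ ∀ W : Submodule ℂ H, IsClosed (W : Set H) →
    (∀ (g : G), ∀ v ∈ W, π g v ∈ W) → W = ⊥ ∨ W = ⊤

end Unitary

/-! ### The left regular representation on `ℓ²(G)` -/

section Regular

variable {G : Type*} [Group G]

theorem memlp_translate (g : G) (f : lp (fun _ : G => ℂ) 2) :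
    Memℓp (fun h => f (g⁻¹ * h) : G → ℂ) 2 := by
  have h := (memℓp_gen_iff (p := 2) (by norm_num)).1 (lp.memℓp f)
  refine memℓp_gen ?_
  exact (Equiv.mulLeft g⁻¹).summable_iff.2 h

/-- The translation operator `(L_g f)(h) = f (g⁻¹ h)` on `ℓ²(G)`. -/
noncomputable def translate (g : G) (f : lp (fun _ : G => ℂ) 2) : lp (fun _ : G => ℂ) 2 :=
  ⟨fun h => f (g⁻¹ * h), memlp_translate g f⟩

@[simp] theorem translate_apply (g : G) (f : lp (fun _ : G => ℂ) 2) (h : G) :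
    translate g f h = f (g⁻¹ * h) := rfl

theorem norm_translate (g : G) (f : lp (fun _ : G => ℂ) 2) : ‖translate g f‖ = ‖f‖ := by
  rw [lp.norm_eq_tsum_rpow (by norm_num), lp.norm_eq_tsum_rpow (by norm_num)]
  congr 1
  exact (Equiv.mulLeft g⁻¹).tsum_eq (fun h => ‖f h‖ ^ (2 : ENNReal).toReal)

/-- The left regular representation of `G` on `ℓ²(G)`. -/
noncomputable def regularRep (G : Type*) [Group G] :
    G →* (lp (fun _ : G => ℂ) 2 ≃ₗᵢ[ℂ] lp (fun _ : G => ℂ) 2) where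
  toFun g :=
    { toFun := translate g
      invFun := translate g⁻¹
      map_add' := fun f f' => by ext h; simp
      map_smul' := fun c f => by ext h; simp
      left_inv := fun f => by ext h; simp
      right_inv := fun f => by ext h; simp
      norm_map' := norm_translate g }
  map_one' := by ext f h; change f (1⁻¹ * h) = f h; simp
  map_mul' g g' := by
    ext f h
    change f ((g * g')⁻¹ * h) = f (g'⁻¹ * (g⁻¹ * h))
    rw [mul_inv_rev, mul_assoc]

end Regular

/-! ### Induction from a subgroup of finite index -/

section Induction

variable {G : Type*} [Group G] {Γ : Subgroup G}
variable {K : Type*} [NormedAddCommGroup K] [InnerProductSpace ℂ K]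

/-- The functions `f : G → K` with `σ(γ) f(g) = f(g γ⁻¹)` for `γ ∈ Γ`, `g ∈ G`. -/
def indSubmodule (σ : Γ →* (K ≃ₗᵢ[ℂ] K)) : Submodule ℂ (G → K) where
  carrier := {f | ∀ (γ : Γ) (g : G), σ γ (f g) = f (g * (γ : G)⁻¹)}
  add_mem' := fun {f f'} hf hf' γ g => by simp [hf γ g, hf' γ g]
  zero_mem' := fun γ g => by simp
  smul_mem' := fun c f hf γ g => by simp [hf γ g]

/-- The space of the induced representation. -/
def IndSpace (σ : Γ →* (K ≃ₗᵢ[ℂ] K)) : Type _ := ↥(indSubmodule σ)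

variable (σ : Γ →* (K ≃ₗᵢ[ℂ] K))

instance : AddCommGroup (IndSpace σ) := inferInstanceAs (AddCommGroup ↥(indSubmodule σ))
instance : Module ℂ (IndSpace σ) := inferInstanceAs (Module ℂ ↥(indSubmodule σ))
instance : FunLike (IndSpace σ) G K := ⟨fun f => f.1, fun _ _ h => Subtype.ext h⟩

variable {σ}

theorem IndSpace.equivariant (f : IndSpace σ) (γ : Γ) (g : G) :
    σ γ (f g) = f (g * (γ : G)⁻¹) := f.2 γ g

@[ext] theorem IndSpace.ext {f f' : IndSpace σ} (h : ∀ g, f g = f' g) : f = f' :=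
  DFunLike.ext _ _ h

@[simp] theorem IndSpace.add_apply (f f' : IndSpace σ) (g : G) : (f + f') g = f g + f' g := rfl
@[simp] theorem IndSpace.smul_apply (c : ℂ) (f : IndSpace σ) (g : G) : (c • f) g = c • f g := rfl
@[simp] theorem IndSpace.zero_apply (g : G) : (0 : IndSpace σ) g = 0 := rfl

/-- `⟪f g, f' g⟫` depends only on the coset `g Γ`. -/
theorem IndSpace.inner_coset (f f' : IndSpace σ) {g h : G} (hgh : (g : G ⧸ Γ) = h) :
    inner ℂ (f g) (f' g) = inner ℂ (f h) (f' h) := by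
  have hm : h⁻¹ * g ∈ Γ := QuotientGroup.eq.1 hgh.symm
  have e : h = g * ((⟨h⁻¹ * g, hm⟩ : Γ) : G)⁻¹ := by simp
  rw [e, ← f.equivariant, ← f'.equivariant, LinearIsometryEquiv.inner_map_map]

/-- Left translation on the space of the induced representation. -/
def indTranslate (σ : Γ →* (K ≃ₗᵢ[ℂ] K)) (g : G) : IndSpace σ →ₗ[ℂ] IndSpace σ where
  toFun f := ⟨fun h => f (g⁻¹ * h), fun γ h => by rw [f.equivariant, mul_assoc]⟩
  map_add' _ _ := rfl
  map_smul' _ _ := rfl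

@[simp] theorem indTranslate_apply (g : G) (f : IndSpace σ) (h : G) :
    indTranslate σ g f h = f (g⁻¹ * h) := rfl

variable [Γ.FiniteIndex]

attribute [local instance] Subgroup.fintypeQuotientOfFiniteIndex

/-- The inner product `⟪f, f'⟫ = ∑_{u} ⟪f(u), f'(u)⟫`, with `u` running through a set of
representatives of the finite set `G ⧸ Γ`. -/
@[reducible] noncomputable def indCore (σ : Γ →* (K ≃ₗᵢ[ℂ] K)) : InnerProductSpace.Core ℂ (IndSpace σ) where
  inner f f' := ∑ q : G ⧸ Γ, inner ℂ (f q.out) (f' q.out)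
  conj_inner_symm f f' := by simp [map_sum]
  re_inner_nonneg f := by
    rw [map_sum]
    exact Finset.sum_nonneg fun q _ => inner_self_nonneg
  add_left f f' f'' := by simp [Finset.sum_add_distrib]
  smul_left f f' c := by simp [Finset.mul_sum, mul_comm]
  definite f hf := by
    have h0 : ∀ q : G ⧸ Γ, f q.out = 0 := by
      have h1 : ∑ q : G ⧸ Γ, ‖f q.out‖ ^ 2 = 0 := by
        have h2 := congrArg Complex.re hf
        simp only [Complex.re_sum, Complex.zero_re] at h2
        rw [← h2]
        refine Finset.sum_congr rfl fun q _ => ?_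
        exact (inner_self_eq_norm_sq (𝕜 := ℂ) (f q.out)).symm
      intro q
      have h3 := (Finset.sum_eq_zero_iff_of_nonneg (fun q _ => by positivity)).1 h1 q
        (Finset.mem_univ q)
      simpa using h3
    ext g
    have h4 := f.inner_coset f (g := g) (h := (g : G ⧸ Γ).out) (QuotientGroup.out_eq' _).symm
    rw [h0, inner_zero_left, inner_self_eq_zero] at h4
    exact h4

noncomputable instance : NormedAddCommGroup (IndSpace σ) :=
  (indCore σ).toNormedAddCommGroup

noncomputable instance : InnerProductSpace ℂ (IndSpace σ) :=
  InnerProductSpace.ofCore (indCore σ).toCore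

theorem IndSpace.inner_def (f f' : IndSpace σ) :
    inner ℂ f f' = ∑ q : G ⧸ Γ, inner ℂ (f q.out) (f' q.out) := rfl

theorem inner_indTranslate (g : G) (f f' : IndSpace σ) :
    inner ℂ (indTranslate σ g f) (indTranslate σ g f') = inner ℂ f f' := by
  rw [IndSpace.inner_def, IndSpace.inner_def]
  refine Fintype.sum_equiv (MulAction.toPerm (g⁻¹ : G) : Equiv.Perm (G ⧸ Γ)) _ _ fun q => ?_
  simp only [indTranslate_apply, MulAction.toPerm_apply]
  refine IndSpace.inner_coset f f' ?_
  rw [QuotientGroup.out_eq']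
  conv_rhs => rw [← QuotientGroup.out_eq' q]
  rfl

/-- The unitary representation of `G` induced by the unitary representation `σ` of the subgroup
`Γ` of finite index: `(ρ(g) f)(h) = f (g⁻¹ h)`. -/
noncomputable def indRep (σ : Γ →* (K ≃ₗᵢ[ℂ] K)) : G →* (IndSpace σ ≃ₗᵢ[ℂ] IndSpace σ) where
  toFun g :=
    { indTranslate σ g with
      invFun := indTranslate σ g⁻¹
      left_inv := fun f => by
        change indTranslate σ g⁻¹ (indTranslate σ g f) = f
        ext h; simp
      right_inv := fun f => by
        change indTranslate σ g (indTranslate σ g⁻¹ f) = f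
        ext h; simp
      norm_map' := fun f => by
        change ‖indTranslate σ g f‖ = ‖f‖
        rw [norm_eq_sqrt_re_inner (𝕜 := ℂ), norm_eq_sqrt_re_inner (𝕜 := ℂ) f,
          inner_indTranslate] }
  map_one' := by ext f h; change f (1⁻¹ * h) = f h; simp
  map_mul' g g' := by
    ext f h
    change f ((g * g')⁻¹ * h) = f (g'⁻¹ * (g⁻¹ * h))
    rw [mul_inv_rev, mul_assoc]

end Induction

/-! ### Word length in a free group -/

section Words

variable {Γ : Type*} [Group Γ] {n : ℕ} (b : FreeGroupBasis (Fin n) Γ)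

/-- The index set of the symmetric set `A` of free generators attached to a basis of cardinality
`n`: the pair `(i, true)` stands for the `i`-th basis element and `(i, false)` for its inverse. -/
abbrev Letter (n : ℕ) : Type := Fin n × Bool

/-- The inverse letter. -/
def Letter.inv (a : Letter n) : Letter n := (a.1, !a.2)

/-- The generator, as an element of the group, that corresponds to a letter. -/
def gen (a : Letter n) : Γ := if a.2 then b a.1 else (b a.1)⁻¹

/-- The word length `|x|` with respect to the symmetric set of free generators. -/
def len (x : Γ) : ℕ := (b.repr x).norm

/-- The word `x a` is reduced, that is, the reduced word of `x` does not end in `a⁻¹`. -/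
def RedMul (x : Γ) (a : Letter n) : Prop := len b (x * gen b a) = len b x + 1

/-- The reduced word of `x`. -/
def word (x : Γ) : List (Letter n) := (b.repr x).toWord

theorem len_eq (x : Γ) : len b x = (word b x).length := rfl

theorem word_injective : Function.Injective (word b) :=
  FreeGroup.toWord_injective.comp b.repr.injective

theorem isReduced_word (x : Γ) : FreeGroup.IsReduced (word b x) := FreeGroup.isReduced_toWord

theorem repr_gen (a : Letter n) : b.repr (gen b a) = FreeGroup.mk [a] := by
  obtain ⟨i, ε⟩ := a
  cases ε
  · simp [gen, FreeGroup.of, FreeGroup.invRev]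
  · simp [gen, FreeGroup.of]

theorem word_mul_gen (x : Γ) (a : Letter n) :
    word b (x * gen b a) = FreeGroup.reduce (word b x ++ [a]) := by
  rw [word, map_mul, repr_gen, FreeGroup.toWord_mul, FreeGroup.toWord_mk,
    FreeGroup.reduce_singleton, word]

theorem word_gen_mul (x : Γ) (a : Letter n) :
    word b (gen b a * x) = FreeGroup.reduce (a :: word b x) := by
  rw [word, map_mul, repr_gen, FreeGroup.toWord_mul, FreeGroup.toWord_mk,
    FreeGroup.reduce_singleton, word, List.singleton_append]

theorem redMul_iff (x : Γ) (a : Letter n) :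
    RedMul b x a ↔ FreeGroup.IsReduced (word b x ++ [a]) := by
  rw [RedMul, len_eq, len_eq, word_mul_gen, FreeGroup.isReduced_iff_reduce_eq]
  constructor
  · intro h
    exact FreeGroup.reduce.red.sublist.eq_of_length (by simpa using h)
  · intro h
    rw [h, List.length_append, List.length_singleton]

theorem RedMul.word_eq {x : Γ} {a : Letter n} (h : RedMul b x a) :
    word b (x * gen b a) = word b x ++ [a] := by
  rw [word_mul_gen, ((redMul_iff b x a).1 h).reduce_eq]

theorem exists_redMul {y : Γ} (hy : len b y ≠ 0) :
    ∃ x a, RedMul b x a ∧ y = x * gen b a := by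
  have hne : word b y ≠ [] := fun h => hy (by rw [len_eq, h, List.length_nil])
  obtain ⟨L, a, hL⟩ : ∃ L a, word b y = L ++ [a] :=
    ⟨_, _, (List.dropLast_append_getLast hne).symm⟩
  have hred : FreeGroup.IsReduced (L ++ [a]) := hL ▸ isReduced_word b y
  have hredL : FreeGroup.IsReduced L := hred.infix ⟨[], [a], by simp⟩
  have hw : word b (b.repr.symm (FreeGroup.mk L)) = L := by
    rw [word, MulEquiv.apply_symm_apply, FreeGroup.toWord_mk, hredL.reduce_eq]
  have hR : RedMul b (b.repr.symm (FreeGroup.mk L)) a := by rw [redMul_iff, hw]; exact hred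
  exact ⟨_, a, hR, word_injective b (by rw [hR.word_eq, hw, hL])⟩

/-- After a reduced word `x a`, the letter `d` cancels exactly when `d = a⁻¹`. -/
theorem RedMul.redMul_iff_ne {x : Γ} {a : Letter n} (h : RedMul b x a) (d : Letter n) :
    RedMul b (x * gen b a) d ↔ d ≠ a.inv := by
  rw [redMul_iff, h.word_eq]
  have key : FreeGroup.IsReduced [a, d] ↔ d ≠ a.inv := by
    rw [FreeGroup.isReduced_cons_cons]
    obtain ⟨i, ε⟩ := a
    obtain ⟨j, δ⟩ := d
    simp only [FreeGroup.IsReduced.singleton, and_true, Letter.inv, ne_eq, Prod.mk.injEq, not_and]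
    constructor
    · rintro hh rfl rfl
      simpa using hh rfl
    · rintro hh rfl
      have := hh rfl
      cases ε <;> cases δ <;> simp_all
  rw [← key]
  constructor
  · intro hh
    exact hh.infix ⟨word b x, [], by simp⟩
  · intro hh
    have := ((redMul_iff b x a).1 h).append_overlap (L₃ := [d]) hh (by simp)
    simpa using this

theorem len_mul_le (x y : Γ) : len b (x * y) ≤ len b x + len b y := by
  rw [len, map_mul]; exact FreeGroup.norm_mul_le _ _

theorem len_inv (x : Γ) : len b x⁻¹ = len b x := by
  rw [len, map_inv, FreeGroup.norm_inv_eq]; rfl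

theorem len_le_mul (x y : Γ) : len b y ≤ len b x + len b (x * y) := by
  have := len_mul_le b x⁻¹ (x * y)
  rwa [inv_mul_cancel_left, len_inv] at this

theorem RedMul.gen_mul {y : Γ} {a : Letter n} (h : RedMul b y a) (hy : len b y ≠ 0)
    (s : Letter n) : RedMul b (gen b s * y) a := by
  rw [redMul_iff] at h ⊢
  have hne : word b y ≠ [] := fun h => hy (by rw [len_eq, h, List.length_nil])
  have hw := isReduced_word b y
  rw [word_gen_mul]
  generalize word b y = L at *
  cases L with
  | nil => exact absurd rfl hne
  | cons c t =>
    by_cases hs : FreeGroup.IsReduced (s :: c :: t)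
    · rw [hs.reduce_eq]
      have := FreeGroup.IsReduced.append_overlap (L₁ := [s]) (L₂ := c :: t) (L₃ := [a])
        (by simpa using hs) h hne
      simpa using this
    · rw [FreeGroup.isReduced_cons_cons] at hs
      have hs' : s.1 = c.1 ∧ s.2 = !c.2 := by
        by_contra hcon
        refine hs ⟨fun h1 => ?_, hw⟩
        by_contra h2
        exact hcon ⟨h1, by cases h3 : s.2 <;> cases h4 : c.2 <;> simp_all⟩
      have hred : FreeGroup.reduce (s :: c :: t) = t := by
        rw [FreeGroup.reduce.cons, hw.reduce_eq]
        simp [hs'.1, hs'.2]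
      rw [hred]
      exact h.infix ⟨[c], [], by simp⟩

/-- Left multiplication by a short element does not disturb the end of a long word. -/
theorem RedMul.mul_left {y : Γ} {a : Letter n} (h : RedMul b y a) (x : Γ)
    (hxy : len b x ≤ len b y) : RedMul b (x * y) a := by
  suffices H : ∀ (l : List (Letter n)), l.length ≤ len b y →
      RedMul b (b.repr.symm (FreeGroup.mk l) * y) a ∧
        len b y ≤ l.length + len b (b.repr.symm (FreeGroup.mk l) * y) by
    have := (H (word b x) hxy).1
    rwa [word, FreeGroup.mk_toWord, MulEquiv.symm_apply_apply] at this
  intro l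
  induction l with
  | nil => intro _; simpa [← FreeGroup.one_eq_mk] using h
  | cons s l ih =>
    intro hl
    rw [List.length_cons] at hl
    obtain ⟨h1, h2⟩ := ih (by omega)
    have e : b.repr.symm (FreeGroup.mk (s :: l)) * y
        = gen b s * (b.repr.symm (FreeGroup.mk l) * y) := by
      apply b.repr.injective
      simp [repr_gen, ← mul_assoc]
    rw [e]
    refine ⟨h1.gen_mul b (by omega) s, ?_⟩
    have h3 := len_le_mul b (gen b s) (b.repr.symm (FreeGroup.mk l) * y)
    have h4 : len b (gen b s) ≤ 1 := by
      rw [len, repr_gen]; exact FreeGroup.norm_mk_le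
    rw [List.length_cons]
    omega

theorem finite_sphere (N : ℕ) : {x : Γ | len b x = N}.Finite :=
  Set.Finite.of_finite_image
    ((List.finite_length_eq (Letter n) N).subset (by rintro _ ⟨x, hx, rfl⟩; exact hx))
    (word_injective b).injOn

/-- The sphere `{x : |x| = N}`. -/
noncomputable def sphere (N : ℕ) : Finset Γ := (finite_sphere b N).toFinset

@[simp] theorem mem_sphere {N : ℕ} {x : Γ} : x ∈ sphere b N ↔ len b x = N := by
  simp [sphere]

end Words

/-! ### Matrix systems with inner product -/

/-- A matrix system with inner product `(V_a, H_{ba}, B_a)` over the symmetric set `A` of letters: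
complex vector spaces `V_a`, linear maps `H_{ba} : V_a → V_b` with `H_{ba} = 0` when `b = a⁻¹`, and
positive semidefinite sesquilinear forms `B_a` (conjugate linear in the first variable) that satisfy
the compatibility condition `B_a(v, v) = ∑_b B_b(H_{ba} v, H_{ba} v)`. -/
structure MatrixSystem (n : ℕ) where
  /-- the vector spaces `V_a` -/
  V : Letter n → Type v
  [instAddCommGroup : ∀ a, AddCommGroup (V a)]
  [instModule : ∀ a, Module ℂ (V a)]
  /-- the linear maps `H_{ba}`, written `H b a` -/
  H : ∀ b a, V a →ₗ[ℂ] V b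
  H_inv : ∀ a, H a.inv a = 0
  /-- the forms `B_a` -/
  B : ∀ a, V a →ₗ⋆[ℂ] V a →ₗ[ℂ] ℂ
  posSemidef : ∀ a, (B a).IsPosSemidef
  compat : ∀ a (v : V a), B a v v = ∑ b, B b (H b a v) (H b a v)

attribute [instance] MatrixSystem.instAddCommGroup MatrixSystem.instModule

theorem MatrixSystem.compat₂ {n : ℕ} (S : MatrixSystem.{v} n) (a : Letter n) (v w : S.V a) :
    S.B a v w = ∑ b, S.B b (S.H b a v) (S.H b a w) := by
  have h1 := S.compat a (v + w)
  have h2 := S.compat a (v + Complex.I • w)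
  have hv := S.compat a v
  have hw := S.compat a w
  simp only [map_add, LinearMap.add_apply, LinearMap.map_smulₛₗ, LinearMap.smul_apply, map_smul,
    Finset.sum_add_distrib, smul_eq_mul, Complex.conj_I,
    ← Finset.mul_sum, ← hv, ← hw] at h1 h2
  have e1 : S.B a v w + S.B a w v
      = ∑ b, S.B b (S.H b a v) (S.H b a w) + ∑ b, S.B b (S.H b a w) (S.H b a v) := by
    linear_combination h1
  have e2 : Complex.I * (S.B a v w - S.B a w v)
      = Complex.I * (∑ b, S.B b (S.H b a v) (S.H b a w)
          - ∑ b, S.B b (S.H b a w) (S.H b a v)) := by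
    linear_combination h2
  have e3 := mul_left_cancel₀ Complex.I_ne_zero e2
  linear_combination (e1 + e3) / 2

/-! ### Multiplicative functions -/

section Multiplicative

variable {Γ : Type u} [Group Γ] {n : ℕ} (b : FreeGroupBasis (Fin n) Γ) (S : MatrixSystem.{v} n)

/-- The rule for multiplicative functions, outside the ball of radius `N`. The values of `f` lie
in the direct sum of the spaces `V_a`, in which `V_a` is identified with the vectors supported at
`a`: if `y = x a` is reduced and `|y| ≥ N`, then `f(y) ∈ V_a`, and `f(y d) = H_{da} f(y) ∈ V_d`
for all `d ≠ a⁻¹`. -/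
def MultFrom (N : ℕ) (f : Γ → ∀ a, S.V a) : Prop :=
  ∀ (x : Γ) (a : Letter n), RedMul b x a → N ≤ len b (x * gen b a) →
    f (x * gen b a) = Pi.single a (f (x * gen b a) a) ∧
    ∀ d : Letter n, d ≠ a.inv →
      f (x * gen b a * gen b d) = Pi.single d (S.H d a (f (x * gen b a) a))

variable {b S} in
theorem MultFrom.mono {N M : ℕ} (hNM : N ≤ M) {f : Γ → ∀ a, S.V a} (hf : MultFrom b S N f) :
    MultFrom b S M f := fun x a hx hM => hf x a hx (hNM.trans hM)

/-- The vector space of multiplicative functions. -/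
def multFun : Submodule ℂ (Γ → ∀ a, S.V a) where
  carrier := {f | ∃ N, MultFrom b S N f}
  zero_mem' := ⟨0, fun x a _ _ => by simp⟩
  add_mem' := by
    rintro f g ⟨N, hN⟩ ⟨M, hM⟩
    refine ⟨max N M, fun x a hx hl => ?_⟩
    obtain ⟨h1, h2⟩ := hN.mono (le_max_left N M) x a hx hl
    obtain ⟨h3, h4⟩ := hM.mono (le_max_right N M) x a hx hl
    refine ⟨?_, fun d hd => ?_⟩
    · rw [Pi.add_apply, Pi.add_apply, Pi.single_add, ← h1, ← h3]
    · rw [Pi.add_apply, Pi.add_apply, Pi.add_apply, map_add, Pi.single_add, h2 d hd, h4 d hd]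
  smul_mem' := by
    rintro c f ⟨N, hN⟩
    refine ⟨N, fun x a hx hl => ?_⟩
    obtain ⟨h1, h2⟩ := hN x a hx hl
    refine ⟨?_, fun d hd => ?_⟩
    · rw [Pi.smul_apply, Pi.smul_apply, Pi.single_smul, ← h1]
    · rw [Pi.smul_apply, Pi.smul_apply, Pi.smul_apply, map_smul, Pi.single_smul, h2 d hd]

/-- The functions that vanish outside a finite set of words. -/
def finFun : Submodule ℂ (multFun b S) where
  carrier := {f | {x | f.1 x ≠ 0}.Finite}
  zero_mem' := by simp
  add_mem' := by
    intro f g hf hg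
    refine (hf.union hg).subset fun x hx => ?_
    by_contra h
    simp only [Set.mem_union, Set.mem_ofPred_eq, not_or, not_not] at h
    exact hx (by simp [h.1, h.2])
  smul_mem' := by
    intro c f hf
    refine hf.subset fun x hx => ?_
    by_contra h
    simp only [Set.mem_ofPred_eq, not_not] at h
    exact hx (by simp [h])

/-- The space `𝓗^∞` of multiplicative functions modulo equality outside a finite set of words. -/
def HInf : Type (max u v) := multFun b S ⧸ finFun b S

noncomputable instance : AddCommGroup (HInf b S) :=
  inferInstanceAs (AddCommGroup (multFun b S ⧸ finFun b S))
noncomputable instance : Module ℂ (HInf b S) :=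
  inferInstanceAs (Module ℂ (multFun b S ⧸ finFun b S))

/-- The class of a multiplicative function. -/
noncomputable def HInf.mk : multFun b S →ₗ[ℂ] HInf b S := (finFun b S).mkQ

variable {b S}

theorem HInf.mk_surjective : Function.Surjective (HInf.mk b S) := Submodule.mkQ_surjective _

theorem HInf.mk_eq_mk {f g : multFun b S} :
    HInf.mk b S f = HInf.mk b S g ↔ {x | f.1 x ≠ g.1 x}.Finite := by
  have : HInf.mk b S f = HInf.mk b S g ↔ f - g ∈ finFun b S := Submodule.Quotient.eq _
  rw [this]
  change {x | f.1 x - g.1 x ≠ 0}.Finite ↔ _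
  simp only [sub_ne_zero]

/-! ### The action of the free group -/

/-- `(π(x) f)(y) = f(x⁻¹ y)` on multiplicative functions. -/
def actFun (x : Γ) : multFun b S →ₗ[ℂ] multFun b S where
  toFun f := ⟨fun y => f.1 (x⁻¹ * y), by
    obtain ⟨N, hN⟩ := f.2
    refine ⟨N + len b x + 1, fun y a hy hl => ?_⟩
    have h1 : len b (y * gen b a) = len b y + 1 := hy
    have h2 : RedMul b (x⁻¹ * y) a := hy.mul_left b x⁻¹ (by rw [len_inv]; omega)
    have h3 := len_le_mul b x⁻¹ (y * gen b a)
    rw [len_inv] at h3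
    have h4 := hN (x⁻¹ * y) a h2 (by rw [mul_assoc]; omega)
    simpa only [mul_assoc] using h4⟩
  map_add' _ _ := rfl
  map_smul' _ _ := rfl

@[simp] theorem actFun_apply (x : Γ) (f : multFun b S) (y : Γ) :
    (actFun x f).1 y = f.1 (x⁻¹ * y) := rfl

/-- The operator `π(x)` on `𝓗^∞`. -/
noncomputable def act (x : Γ) : HInf b S →ₗ[ℂ] HInf b S :=
  (finFun b S).mapQ (finFun b S) (actFun x) fun f hf =>
    (Set.Finite.image (fun y => x * y) hf).subset fun y hy => ⟨x⁻¹ * y, hy, by simp⟩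

@[simp] theorem act_mk (x : Γ) (f : multFun b S) :
    act x (HInf.mk b S f) = HInf.mk b S (actFun x f) := rfl

/-! ### The inner product on `𝓗^∞` -/

open scoped Classical in
/-- `∑_{|x| = N} ∑_{|xa| = |x| + 1} B_a(f(xa), g(xa))`. -/
noncomputable def formAt (N : ℕ) (f g : multFun b S) : ℂ :=
  ∑ x ∈ sphere b N, ∑ a with RedMul b x a,
    S.B a (f.1 (x * gen b a) a) (g.1 (x * gen b a) a)

theorem formAt_eq_sphere (N : ℕ) (f g : multFun b S) (F : Γ → ℂ)
    (hF : ∀ x a, RedMul b x a → len b x = N →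
      F (x * gen b a) = S.B a (f.1 (x * gen b a) a) (g.1 (x * gen b a) a)) :
    formAt N f g = ∑ y ∈ sphere b (N + 1), F y := by
  classical
  rw [formAt, Finset.sum_sigma']
  refine Finset.sum_bij (fun p _ => p.1 * gen b p.2) ?_ ?_ ?_ ?_
  · rintro ⟨x, a⟩ h
    simp only [Finset.mem_sigma, mem_sphere, Finset.mem_filter, Finset.mem_univ, true_and] at h ⊢
    rw [← h.1]; exact h.2
  · rintro ⟨x, a⟩ h ⟨x', a'⟩ h' e
    simp only [Finset.mem_sigma, mem_sphere, Finset.mem_filter, Finset.mem_univ, true_and] at h h' e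
    have e1 := congrArg (word b) e
    rw [h.2.word_eq, h'.2.word_eq] at e1
    obtain ⟨e2, e3⟩ := List.append_inj' e1 rfl
    have e4 := word_injective b e2
    simp only [List.cons.injEq, and_true] at e3
    subst e4; subst e3; rfl
  · intro y hy
    rw [mem_sphere] at hy
    obtain ⟨x, a, hx, rfl⟩ := exists_redMul b (y := y) (by omega)
    have : len b (x * gen b a) = len b x + 1 := hx
    refine ⟨⟨x, a⟩, ?_, rfl⟩
    simp only [Finset.mem_sigma, mem_sphere, Finset.mem_filter, Finset.mem_univ, true_and]
    exact ⟨by omega, hx⟩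
  · rintro ⟨x, a⟩ h
    simp only [Finset.mem_sigma, mem_sphere, Finset.mem_filter, Finset.mem_univ, true_and] at h
    exact (hF x a h.2 h.1).symm

theorem formAt_succ {N : ℕ} {f g : multFun b S} (hf : MultFrom b S N f.1)
    (hg : MultFrom b S N g.1) : formAt (N + 1) f g = formAt N f g := by
  classical
  refine (formAt_eq_sphere N f g _ fun x a hx hN => ?_).symm
  have hl : len b (x * gen b a) = len b x + 1 := hx
  obtain ⟨-, hf2⟩ := hf x a hx (by omega)
  obtain ⟨-, hg2⟩ := hg x a hx (by omega)
  rw [S.compat₂, Finset.sum_filter]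
  refine Finset.sum_congr rfl fun d _ => ?_
  by_cases hd : d = a.inv
  · rw [if_neg (fun h => (hx.redMul_iff_ne b d).1 h hd), hd, S.H_inv]
    simp
  · rw [if_pos ((hx.redMul_iff_ne b d).2 hd), hf2 d hd, hg2 d hd, Pi.single_eq_same,
      Pi.single_eq_same]

/-- A radius outside of which `f` follows the rule for multiplicative functions. -/
noncomputable def radius (f : multFun b S) : ℕ := f.2.choose

theorem multFrom_radius (f : multFun b S) : MultFrom b S (radius f) f.1 := f.2.choose_spec

/-- The sesquilinear form `⟨f, g⟩ = ∑_{|x| = N} ∑_{|xa| = |x| + 1} B_a(f(xa), g(xa))`, where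
`N` is so large that both `f` and `g` follow the rule outside the ball of radius `N`. -/
noncomputable def form (f g : multFun b S) : ℂ := formAt (max (radius f) (radius g)) f g

/-- The form does not depend on the choice of `N`. -/
theorem form_eq {N : ℕ} {f g : multFun b S} (hf : MultFrom b S N f.1) (hg : MultFrom b S N g.1) :
    form f g = formAt N f g := by
  have key : ∀ (K : ℕ), MultFrom b S K f.1 → MultFrom b S K g.1 →
      ∀ j, formAt (K + j) f g = formAt K f g := by
    intro K h1 h2 j
    induction j with
    | zero => rfl
    | succ j ih =>
      rw [← ih]
      exact formAt_succ (h1.mono (Nat.le_add_right K j)) (h2.mono (Nat.le_add_right K j))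
  have h1 := key _ ((multFrom_radius f).mono (le_max_left _ (radius g)))
    ((multFrom_radius g).mono (le_max_right (radius f) _)) N
  have h2 := key N hf hg (max (radius f) (radius g))
  rw [form, ← h1, ← h2, add_comm]

theorem form_conj (f g : multFun b S) : conj (form g f) = form f g := by
  rw [form, form, max_comm, formAt, formAt, map_sum]
  refine Finset.sum_congr rfl fun x _ => ?_
  rw [map_sum]
  exact Finset.sum_congr rfl fun a _ => (S.posSemidef a).isSymm.eq _ _

theorem form_nonneg (f : multFun b S) : 0 ≤ form f f :=
  Finset.sum_nonneg fun _ _ => Finset.sum_nonneg fun a _ => (S.posSemidef a).isNonneg.nonneg _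

theorem form_add (f f' g : multFun b S) : form (f + f') g = form f g + form f' g := by
  set N := max (max (radius f) (radius f')) (max (radius (f + f')) (radius g)) with hN
  have h1 : MultFrom b S N f.1 := (multFrom_radius f).mono (by omega)
  have h2 : MultFrom b S N f'.1 := (multFrom_radius f').mono (by omega)
  have h3 : MultFrom b S N (f + f').1 := (multFrom_radius (f + f')).mono (by omega)
  have h4 : MultFrom b S N g.1 := (multFrom_radius g).mono (by omega)
  rw [form_eq h3 h4, form_eq h1 h4, form_eq h2 h4]
  simp [formAt, Finset.sum_add_distrib]

theorem form_smul (c : ℂ) (f g : multFun b S) : form (c • f) g = conj c * form f g := by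
  set N := max (radius f) (max (radius (c • f)) (radius g)) with hN
  have h1 : MultFrom b S N f.1 := (multFrom_radius f).mono (by omega)
  have h3 : MultFrom b S N (c • f).1 := (multFrom_radius (c • f)).mono (by omega)
  have h4 : MultFrom b S N g.1 := (multFrom_radius g).mono (by omega)
  rw [form_eq h3 h4, form_eq h1 h4]
  simp [formAt, Finset.mul_sum]

theorem form_fin {f : multFun b S} (hf : f ∈ finFun b S) (g : multFun b S) : form f g = 0 := by
  classical
  obtain ⟨M, hM⟩ : ∃ M, ∀ x, M < len b x → f.1 x = 0 := by
    obtain ⟨M, hM⟩ := (Set.Finite.image (len b) hf).bddAbove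
    refine ⟨M, fun x hx => ?_⟩
    by_contra h
    exact absurd (hM ⟨x, h, rfl⟩) (by omega)
  set N := max M (max (radius f) (radius g)) with hN
  have h1 : MultFrom b S N f.1 := (multFrom_radius f).mono (by omega)
  have h4 : MultFrom b S N g.1 := (multFrom_radius g).mono (by omega)
  rw [form_eq h1 h4]
  refine Finset.sum_eq_zero fun x hx => Finset.sum_eq_zero fun a ha => ?_
  have h5 : len b (x * gen b a) = len b x + 1 := (Finset.mem_filter.1 ha).2
  rw [mem_sphere] at hx
  rw [hM _ (by omega)]
  simp

theorem form_congr_left {f f' : multFun b S} (h : HInf.mk b S f = HInf.mk b S f')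
    (g : multFun b S) : form f g = form f' g := by
  have h1 : f - f' ∈ finFun b S := (Submodule.Quotient.eq _).1 h
  have h2 := form_add (f - f') f' g
  rwa [sub_add_cancel, form_fin h1, zero_add] at h2

theorem form_congr {f f' g g' : multFun b S} (h : HInf.mk b S f = HInf.mk b S f')
    (h' : HInf.mk b S g = HInf.mk b S g') : form f g = form f' g' := by
  rw [form_congr_left h, ← form_conj, form_congr_left h', form_conj]

/-- A representative of an element of `𝓗^∞`. -/
noncomputable def HInf.rep (φ : HInf b S) : multFun b S := (HInf.mk_surjective φ).choose

@[simp] theorem HInf.mk_rep (φ : HInf b S) : HInf.mk b S φ.rep = φ :=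
  (HInf.mk_surjective φ).choose_spec

variable (b S) in
/-- The (semi-)inner product on `𝓗^∞`. -/
@[reducible] noncomputable def hinfCore : PreInnerProductSpace.Core ℂ (HInf b S) where
  inner φ ψ := form φ.rep ψ.rep
  conj_inner_symm φ ψ := form_conj _ _
  re_inner_nonneg φ := (Complex.nonneg_iff.1 (form_nonneg φ.rep)).1
  add_left φ φ' ψ := by
    rw [← form_add]
    exact form_congr (by simp) rfl
  smul_left φ ψ c := by
    rw [← form_smul]
    exact form_congr (by simp) rfl

noncomputable instance : SeminormedAddCommGroup (HInf b S) :=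
  @InnerProductSpace.Core.toSeminormedAddCommGroup ℂ _ _ _ _ (hinfCore b S)

noncomputable instance : InnerProductSpace ℂ (HInf b S) :=
  InnerProductSpace.ofCore (hinfCore b S)

theorem HInf.inner_mk (f g : multFun b S) :
    inner ℂ (HInf.mk b S f) (HInf.mk b S g) = form f g :=
  form_congr (by simp) (by simp)

variable (b S) in
/-- The Hilbert space `𝓗(V_a, H_{ba}, B_a)`: the (Hausdorff) completion of `𝓗^∞`. -/
abbrev HSpace : Type (max u v) := UniformSpace.Completion (HInf b S)

variable (b S) in
/-- The canonical map of `𝓗^∞` into its completion. -/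
noncomputable def toHSpace : HInf b S →ₗᵢ[ℂ] HSpace b S := UniformSpace.Completion.toComplₗᵢ

end Multiplicative

/-! ### The classes of representations -/

/-- The class `Mult(Γ)` of a finitely generated free group `Γ`: there are a symmetric set of free
generators, a matrix system with inner product, a dense subspace `M` of the space of `ρ` and a
unitary operator `J` onto `𝓗(V_a, H_{ba}, B_a)` that carries `M` onto `𝓗^∞` and intertwines `ρ` on
`M` with the action `(π(x) f)(y) = f(x⁻¹ y)` on `𝓗^∞`. -/
def InMultFree {Γ : Type u} [Group Γ] {K : Type w} [NormedAddCommGroup K] [InnerProductSpace ℂ K]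
    (ρ : Γ →* (K ≃ₗᵢ[ℂ] K)) : Prop :=
  ∃ (n : ℕ) (b : FreeGroupBasis (Fin n) Γ) (S : MatrixSystem.{v} n) (M : Submodule ℂ K)
    (J : K ≃ₗᵢ[ℂ] HSpace b S),
    Dense (M : Set K) ∧
    J '' (M : Set K) = Set.range (toHSpace b S) ∧
    ∀ m ∈ M, ∀ x : Γ, ∀ φ : HInf b S, J m = toHSpace b S φ →
      J (ρ x m) = toHSpace b S (act x φ)

/-- A group is virtually free if it has a free subgroup of finite index. -/
def IsVirtuallyFree (Λ : Type u) [Group Λ] : Prop :=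
  ∃ Γ : Subgroup Λ, Γ.FiniteIndex ∧ IsFreeGroup Γ

section Classes

variable {Λ : Type u} [Group Λ]
variable {H : Type x} [NormedAddCommGroup H] [InnerProductSpace ℂ H]

/-- The class `Mult(Λ)`: subrepresentations of representations that are induced from a
representation of class `Mult(Γ)` of a free subgroup `Γ` of finite index. -/
def InMult (π : Λ →* (H ≃ₗᵢ[ℂ] H)) : Prop :=
  ∃ (Γ : Subgroup Λ) (_ : Γ.FiniteIndex) (_ : IsFreeGroup Γ)
    (K : Type w) (_ : NormedAddCommGroup K) (_ : InnerProductSpace ℂ K) (_ : CompleteSpace K)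
    (σ : Γ →* (K ≃ₗᵢ[ℂ] K)),
    InMultFree.{u, v, w} σ ∧ IsSubrep π (indRep σ)

/-- The class `Mult_irr(Λ)`: the irreducible representations with the same property. -/
def InMultIrr (π : Λ →* (H ≃ₗᵢ[ℂ] H)) : Prop :=
  ∃ (Γ : Subgroup Λ) (_ : Γ.FiniteIndex) (_ : IsFreeGroup Γ)
    (K : Type w) (_ : NormedAddCommGroup K) (_ : InnerProductSpace ℂ K) (_ : CompleteSpace K)
    (σ : Γ →* (K ≃ₗᵢ[ℂ] K)),
    InMultFree.{u, v, w} σ ∧ IsSubrep π (indRep σ) ∧ IsIrred π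

end Classes

end VFree

/-!
Multiplicative functions are truncated explicitly. For multiplicative functions `f`, `f'` of the
free group, the sum of `B (f y) (f' y)` over the sphere of radius `k` does not depend on `k` once
`k` is large (`form_eq_sum_sphere`): this is what the compatibility of the forms `B_a` with the maps
`H_{ba}` means. Restrict `f` and `f'` to an annulus with `m` layers and divide by `√m`. The result
is finitely supported, and since left translation by `x` moves lengths by at most `|x|`, only
`2 |x|` of the layers feel the boundary of the annulus. So the matrix coefficient at `x` of the
truncated functions under left translation differs from `⟨f, π(x) f'⟩` by `O(1 / m)`
(`norm_annulus_sub_le`). A finitely supported function with values in a space with a positive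
semidefinite form amounts to finitely many scalar functions, because its Gram matrix factors as
`Cᴴ * C` (`exists_gram_factor`, `exists_lp_of_form`). Hence `⟨f, π(x) f'⟩` is a limit of sums of
coefficients of the regular representation.

The argument handles finitely many vectors at once, off-diagonal coefficients included
(`MatrixWeaklyContained`), and this is what induction from `Γ` to `Λ` needs: a diagonal coefficient
of the induced representation is a sum, over the cosets of `Γ`, of coefficients between the values
of a function at different coset representatives. Gluing approximating families in `ℓ²(Γ)` along
the cosets gives vectors in `ℓ²(Λ)` with the corresponding coefficients
(`weaklyContained_indRep`). Weak containment passes to subrepresentations.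
-/

namespace VFree

/-! ### Positive semidefinite forms -/

section Forms

variable {V : Type*} [AddCommGroup V] [Module ℂ V] {B : V →ₗ⋆[ℂ] V →ₗ[ℂ] ℂ}

/-- A finite Gram matrix of a positive semidefinite form factors as `Cᴴ * C`. -/
theorem exists_gram_factor (hB : B.IsPosSemidef) {ι : Type*} [Fintype ι] (v : ι → V) :
    ∃ C : Matrix ι ι ℂ, ∀ i j, B (v i) (v j) = ∑ k, conj (C k i) * C k j := by
  classical
  have hG : (Matrix.of fun i j => B (v i) (v j)).PosSemidef := by
    refine Matrix.posSemidef_iff_dotProduct_mulVec.2 ⟨?_, fun c => ?_⟩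
    · ext i j
      exact hB.isSymm.eq _ _
    · have h := hB.isNonneg.nonneg (∑ i, c i • v i)
      convert h using 1
      simp only [dotProduct, Matrix.mulVec, Matrix.of_apply, map_sum, LinearMap.map_smulₛₗ,
        LinearMap.sum_apply, LinearMap.smul_apply, smul_eq_mul, Pi.star_apply, Finset.mul_sum,
        RingHom.id_apply, RCLike.star_def]
      rw [Finset.sum_comm]
      exact Finset.sum_congr rfl fun i _ => Finset.sum_congr rfl fun j _ => by ring
  open scoped MatrixOrder in
  obtain ⟨C, hC⟩ := CStarAlgebra.nonneg_iff_eq_star_mul_self.1 hG.nonneg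
  refine ⟨C, fun i j => ?_⟩
  have h := congrFun (congrFun hC i) j
  simpa [Matrix.mul_apply, Matrix.star_apply] using h

theorem norm_form_le (hB : B.IsPosSemidef) (v w : V) :
    ‖B v w‖ ≤ ((B v v).re + (B w w).re) / 2 := by
  -- Rotating `v` by a phase `z` makes `B (z • v) w` the negative of its absolute value.
  obtain ⟨z, hz, hzB⟩ : ∃ z : ℂ, ‖z‖ = 1 ∧ conj z * B v w = -(‖B v w‖ : ℂ) := by
    by_cases h0 : B v w = 0
    · exact ⟨1, by simp, by simp [h0]⟩
    · have hn : (‖B v w‖ : ℂ) ≠ 0 := by simpa using h0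
      refine ⟨-(B v w / ‖B v w‖), by simp [h0], ?_⟩
      have hc : conj (B v w) * B v w = (‖B v w‖ : ℂ) ^ 2 := Complex.conj_mul' _
      rw [map_neg, map_div₀, Complex.conj_ofReal]
      field_simp
      linear_combination -hc
  have h := (Complex.nonneg_iff.1 (hB.isNonneg.nonneg (z • v + w))).1
  have hs : B w v = conj (B v w) := (hB.isSymm.eq v w).symm
  have h1 : B (z • v + w) (z • v + w) = B v v + B w w - 2 * (‖B v w‖ : ℂ) := by
    have h2 : z * B w v = -(‖B v w‖ : ℂ) := by
      rw [hs, ← Complex.conj_conj z, ← map_mul, hzB]; simp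
    have h3 : conj z * z = 1 := by rw [Complex.conj_mul', hz]; simp
    simp only [map_add, LinearMap.add_apply, LinearMap.map_smulₛₗ, LinearMap.smul_apply,
      smul_eq_mul, RingHom.id_apply]
    linear_combination hzB + h2 + h3 * B v v
  rw [h1] at h
  simp at h
  linarith

end Forms

/-- The direct sum of the forms `B_a`, on the space in which multiplicative functions take their
values. -/
def MatrixSystem.totalForm {n : ℕ} (S : MatrixSystem.{v} n) :
    (∀ a, S.V a) →ₗ⋆[ℂ] (∀ a, S.V a) →ₗ[ℂ] ℂ :=
  LinearMap.mk₂'ₛₗ _ _ (fun v w => ∑ a, S.B a (v a) (w a))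
    (fun _ _ _ => by simp [Finset.sum_add_distrib])
    (fun _ _ _ => by simp [Finset.mul_sum])
    (fun _ _ _ => by simp [Finset.sum_add_distrib])
    (fun _ _ _ => by simp [Finset.mul_sum])

theorem MatrixSystem.totalForm_apply {n : ℕ} (S : MatrixSystem.{v} n) (v w : ∀ a, S.V a) :
    S.totalForm v w = ∑ a, S.B a (v a) (w a) := rfl

theorem MatrixSystem.totalForm_single {n : ℕ} (S : MatrixSystem.{v} n) (a : Letter n)
    (v w : S.V a) : S.totalForm (Pi.single a v) (Pi.single a w) = S.B a v w := by
  rw [S.totalForm_apply, Finset.sum_eq_single a]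
  · simp
  · intro c _ hc
    simp [Pi.single_eq_of_ne hc]
  · simp

theorem MatrixSystem.totalForm_isPosSemidef {n : ℕ} (S : MatrixSystem.{v} n) :
    S.totalForm.IsPosSemidef where
  eq v w := by
    rw [S.totalForm_apply, S.totalForm_apply, map_sum]
    exact Finset.sum_congr rfl fun a _ => (S.posSemidef a).isSymm.eq _ _
  nonneg v := Finset.sum_nonneg fun a _ => (S.posSemidef a).isNonneg.nonneg _

/-! ### Sums over spheres -/

section Spheres

variable {Γ : Type u} [Group Γ] {n : ℕ} {b : FreeGroupBasis (Fin n) Γ} {S : MatrixSystem.{v} n}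

theorem form_eq_sum_sphere {N k : ℕ} (hk : N < k) {f g : multFun b S}
    (hf : MultFrom b S N f.1) (hg : MultFrom b S N g.1) :
    form f g = ∑ y ∈ sphere b k, S.totalForm (f.1 y) (g.1 y) := by
  obtain ⟨k, rfl⟩ : ∃ j, k = j + 1 := ⟨k - 1, by omega⟩
  rw [form_eq (hf.mono (Nat.lt_succ_iff.1 hk)) (hg.mono (Nat.lt_succ_iff.1 hk))]
  refine formAt_eq_sphere _ _ _ _ fun x a hx hl => ?_
  have hl' : len b (x * gen b a) = len b x + 1 := hx
  rw [(hf x a hx (by omega)).1, (hg x a hx (by omega)).1, S.totalForm_single]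
  simp

variable (b) in
/-- The annulus `{y : N < |y| ≤ N + m}`. -/
noncomputable def annulus (N m : ℕ) : Finset Γ := by
  classical exact (Finset.Ioc N (N + m)).biUnion (sphere b)

theorem mem_annulus {N m : ℕ} {y : Γ} : y ∈ annulus b N m ↔ N < len b y ∧ len b y ≤ N + m := by
  simp [annulus]

theorem sum_annulus {M : Type*} [AddCommMonoid M] (N m : ℕ) (F : Γ → M) :
    ∑ y ∈ annulus b N m, F y = ∑ k ∈ Finset.Ioc N (N + m), ∑ y ∈ sphere b k, F y := by
  classical
  rw [annulus]
  refine Finset.sum_biUnion fun i _ j _ hij => Finset.disjoint_left.2 fun y hi hj => hij ?_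
  rw [← (mem_sphere b).1 hi, ← (mem_sphere b).1 hj]

open scoped Classical in
/-- Summed over the annulus, the points of the annulus that translation by `x⁻¹` keeps in it yield
`m` times the form, up to an error that does not depend on `m`: only the `2 |x|` spheres next to
the boundary of the annulus have points that leave it, and each sphere contributes a bounded
amount. -/
theorem norm_annulus_sub_le {N : ℕ} {f g : multFun b S} (x : Γ) (hf : MultFrom b S N f.1)
    (hg : MultFrom b S N (actFun x g).1) (m : ℕ) :
    ‖∑ y ∈ annulus b N m with x⁻¹ * y ∈ annulus b N m, S.totalForm (f.1 y) (g.1 (x⁻¹ * y))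
        - m * form f (actFun x g)‖
      ≤ len b x * ((form f f).re + (form (actFun x g) (actFun x g)).re) := by
  set g' := actFun x g with hg'
  set C := (form f f).re + (form g' g').re with hC
  have hC0 : 0 ≤ C := add_nonneg (Complex.nonneg_iff.1 (form_nonneg f)).1
    (Complex.nonneg_iff.1 (form_nonneg g')).1
  set bad := (Finset.Ioc N (N + len b x)) ∪ Finset.Ioc (N + m - len b x) (N + m) with hbad
  have hcard : bad.card ≤ 2 * len b x := by
    refine (Finset.card_union_le _ _).trans ?_
    simp only [Nat.card_Ioc]
    omega
  have hm : (m : ℂ) * form f g' = ∑ y ∈ annulus b N m, S.totalForm (f.1 y) (g'.1 y) := by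
    rw [sum_annulus, Finset.sum_congr rfl fun k hk =>
      (form_eq_sum_sphere (Finset.mem_Ioc.1 hk).1 hf hg).symm]
    simp
  have hsplit := Finset.sum_filter_add_sum_filter_not (annulus b N m)
    (fun y => x⁻¹ * y ∈ annulus b N m) fun y => S.totalForm (f.1 y) (g'.1 y)
  have e : ∑ y ∈ annulus b N m with x⁻¹ * y ∈ annulus b N m,
        S.totalForm (f.1 y) (g.1 (x⁻¹ * y)) - m * form f g'
      = -∑ y ∈ annulus b N m with ¬ x⁻¹ * y ∈ annulus b N m,
          S.totalForm (f.1 y) (g'.1 y) := by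
    rw [hm, ← hsplit]
    simp [hg']
  rw [e, norm_neg, Finset.sum_filter, sum_annulus]
  calc ‖∑ k ∈ Finset.Ioc N (N + m), ∑ y ∈ sphere b k,
        if ¬ x⁻¹ * y ∈ annulus b N m then S.totalForm (f.1 y) (g'.1 y) else 0‖
      ≤ ∑ k ∈ Finset.Ioc N (N + m), if k ∈ bad then C / 2 else 0 := by
        refine norm_sum_le_of_le _ fun k hk => ?_
        rw [Finset.mem_Ioc] at hk
        split_ifs with hkb
        · have h1 : C / 2 = ∑ y ∈ sphere b k,
              ((S.totalForm (f.1 y) (f.1 y)).re + (S.totalForm (g'.1 y) (g'.1 y)).re) / 2 := by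
            rw [hC, form_eq_sum_sphere hk.1 hf hf, form_eq_sum_sphere hk.1 hg hg,
              Complex.re_sum, Complex.re_sum, ← Finset.sum_add_distrib, Finset.sum_div]
          rw [h1]
          refine norm_sum_le_of_le _ fun y _ => ?_
          have h2 := norm_form_le S.totalForm_isPosSemidef (f.1 y) (g'.1 y)
          split_ifs
          · simpa using (norm_nonneg _).trans h2
          · exact h2
        · rw [Finset.sum_eq_zero, norm_zero]
          intro y hy
          rw [mem_sphere] at hy
          have h1 := len_mul_le b x⁻¹ y
          have h2 := len_le_mul b x⁻¹ y
          rw [len_inv] at h1 h2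
          simp only [hbad, Finset.mem_union, Finset.mem_Ioc] at hkb
          rw [if_neg]
          rw [not_not, mem_annulus]
          omega
    _ ≤ ∑ k ∈ bad, C / 2 := by
        rw [← Finset.sum_filter]
        refine Finset.sum_le_sum_of_subset_of_nonneg ?_ fun _ _ _ => by positivity
        exact fun k hk => (Finset.mem_filter.1 hk).2
    _ ≤ len b x * C := by
        rw [Finset.sum_const, nsmul_eq_mul]
        have : (bad.card : ℝ) ≤ 2 * len b x := by exact_mod_cast hcard
        nlinarith

end Spheres

/-! ### Weak containment for matrix coefficients -/

/-- The form of weak containment of `π` in `ρ` that concerns finitely many vectors at once: the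
matrix coefficients `⟪ξ i, π g (ξ j)⟫` are simultaneously limits of sums of matrix coefficients of
`ρ`, where the `k`-th summand belongs to a family of vectors `η k i`. -/
def MatrixWeaklyContained {G : Type*} [Group G] {H : Type*} [NormedAddCommGroup H]
    [InnerProductSpace ℂ H] {K : Type*} [NormedAddCommGroup K] [InnerProductSpace ℂ K]
    (π : G →* (H ≃ₗᵢ[ℂ] H)) (ρ : G →* (K ≃ₗᵢ[ℂ] K)) (I : Type*) : Prop :=
  ∀ (ξ : I → H) (Q : Finset G) (ε : ℝ), 0 < ε →
    ∃ (n : ℕ) (η : Fin n → I → K), ∀ i j, ∀ g ∈ Q,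
      ‖inner ℂ (ξ i) (π g (ξ j)) - ∑ k, inner ℂ (η k i) (ρ g (η k j))‖ < ε

/-- A family of finitely supported functions `F i` with values in a space with a positive
semidefinite form has the same matrix coefficients, under left translation, as a finite number of
families in `ℓ²(G)`. -/
theorem exists_lp_of_form {G : Type*} [Group G] {V : Type*} [AddCommGroup V] [Module ℂ V]
    {B : V →ₗ⋆[ℂ] V →ₗ[ℂ] ℂ} (hB : B.IsPosSemidef) {I : Type*} [Finite I] (s : Finset G)
    (F : I → G → V) [DecidablePred (· ∈ s)] :
    ∃ (n : ℕ) (η : Fin n → I → lp (fun _ : G => ℂ) 2), ∀ i j g,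
      ∑ k, inner ℂ (η k i) (regularRep G g (η k j))
        = ∑ y ∈ s with g⁻¹ * y ∈ s, B (F i y) (F j (g⁻¹ * y)) := by
  classical
  have := Fintype.ofFinite I
  obtain ⟨C, hC⟩ := exists_gram_factor hB (fun p : I × s => F p.1 p.2)
  let e := (Fintype.equivFin (I × s)).symm
  let c : Fin (Fintype.card (I × s)) → I → G → ℂ :=
    fun k i y => if h : y ∈ s then C (e k) (i, ⟨y, h⟩) else 0
  have hc : ∀ k i y, y ∉ s → c k i y = 0 := fun k i y h => dif_neg h
  have hmem : ∀ k i, Memℓp (c k i) 2 := fun k i => memℓp_gen <|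
    summable_of_ne_finset_zero (s := s) fun y hy => by simp [hc k i y hy]
  refine ⟨_, fun k i => ⟨c k i, hmem k i⟩, fun i j g => ?_⟩
  have h1 : ∀ k, inner ℂ (⟨c k i, hmem k i⟩ : lp (fun _ : G => ℂ) 2)
      (regularRep G g ⟨c k j, hmem k j⟩)
        = ∑ y ∈ s with g⁻¹ * y ∈ s, conj (c k i y) * c k j (g⁻¹ * y) := by
    intro k
    rw [lp.inner_eq_tsum, tsum_eq_sum (s := s.filter fun y => g⁻¹ * y ∈ s)]
    · exact Finset.sum_congr rfl fun y _ => mul_comm _ _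
    · intro y hy
      change c k j (g⁻¹ * y) * conj (c k i y) = 0
      by_cases h : y ∈ s
      · rw [hc k j _ fun h' => hy (Finset.mem_filter.2 ⟨h, h'⟩), zero_mul]
      · rw [hc k i y h, map_zero, mul_zero]
  rw [Finset.sum_congr rfl fun k _ => h1 k, Finset.sum_comm]
  refine Finset.sum_congr rfl fun y hy => ?_
  obtain ⟨hy1, hy2⟩ := Finset.mem_filter.1 hy
  rw [hC (i, ⟨y, hy1⟩) (j, ⟨g⁻¹ * y, hy2⟩), ← e.sum_comp]
  exact Finset.sum_congr rfl fun k _ => by simp only [c, dif_pos hy1, dif_pos hy2]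

/-! ### Temperedness over a free group -/

section Free

variable {Γ : Type u} [Group Γ] {n : ℕ} {b : FreeGroupBasis (Fin n) Γ} {S : MatrixSystem.{v} n}

/-- The coefficients of multiplicative functions are limits of coefficients of the regular
representation: truncate the functions to an annulus with `m` layers and divide by `√m`. -/
theorem exists_lp_of_multFun {I : Type*} [Finite I] (f : I → multFun b S) (Q : Finset Γ) {ε : ℝ}
    (hε : 0 < ε) :
    ∃ (m : ℕ) (η : Fin m → I → lp (fun _ : Γ => ℂ) 2), ∀ i j, ∀ x ∈ Q,
      ‖form (f i) (actFun x (f j)) - ∑ k, inner ℂ (η k i) (regularRep Γ x (η k j))‖ < ε := by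
  classical
  have hev : ∀ h : multFun b S, ∀ᶠ N in Filter.atTop, MultFrom b S N h.1 := fun h =>
    Filter.eventually_atTop.2 ⟨radius h, fun N hN => (multFrom_radius h).mono hN⟩
  obtain ⟨N, hN1, hN2⟩ : ∃ N, (∀ i, MultFrom b S N (f i).1) ∧
      ∀ j, ∀ x ∈ Q, MultFrom b S N (actFun x (f j)).1 :=
    ((Filter.eventually_all.2 fun i => hev (f i)).and (Filter.eventually_all.2 fun j =>
      (Filter.eventually_all_finset Q).2 fun x _ => hev (actFun x (f j)))).exists
  let C : I → I → Γ → ℝ := fun i j x =>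
    len b x * ((form (f i) (f i)).re + (form (actFun x (f j)) (actFun x (f j))).re)
  obtain ⟨m, hm0, hm⟩ : ∃ m : ℕ, 0 < m ∧ ∀ i j, ∀ x ∈ Q, C i j x / m < ε :=
    ((Filter.eventually_gt_atTop 0).and (Filter.eventually_all.2 fun i =>
      Filter.eventually_all.2 fun j => (Filter.eventually_all_finset Q).2 fun x _ =>
        (tendsto_const_div_atTop_nhds_zero_nat (C i j x)).eventually_lt_const hε)).exists
  have hm0' : (0 : ℝ) < m := by exact_mod_cast hm0
  have hmC : (m : ℂ) ≠ 0 := by exact_mod_cast hm0.ne'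
  obtain ⟨p, η, hη⟩ := exists_lp_of_form S.totalForm_isPosSemidef (annulus b N m)
    (fun i y => ((√m : ℝ) : ℂ)⁻¹ • (f i).1 y)
  refine ⟨p, η, fun i j x hx => ?_⟩
  have hsqrt : ((√m : ℝ) : ℂ)⁻¹ * ((√m : ℝ) : ℂ)⁻¹ = (m : ℂ)⁻¹ := by
    rw [← mul_inv, ← Complex.ofReal_mul, Real.mul_self_sqrt hm0'.le, Complex.ofReal_natCast]
  have key := norm_annulus_sub_le x (hN1 i) (hN2 j x hx) m
  set T := ∑ y ∈ annulus b N m with x⁻¹ * y ∈ annulus b N m,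
    S.totalForm ((f i).1 y) ((f j).1 (x⁻¹ * y)) with hT
  have h1 : ∑ k, inner ℂ (η k i) (regularRep Γ x (η k j)) = (m : ℂ)⁻¹ * T := by
    rw [hη, hT, Finset.mul_sum]
    refine Finset.sum_congr rfl fun y _ => ?_
    simp only [LinearMap.map_smulₛₗ, LinearMap.smul_apply, smul_eq_mul, RingHom.id_apply,
      map_inv₀, Complex.conj_ofReal]
    rw [← mul_assoc, hsqrt]
  have h2 : form (f i) (actFun x (f j)) - (m : ℂ)⁻¹ * T
      = -((m : ℂ)⁻¹ * (T - m * form (f i) (actFun x (f j)))) := by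
    field_simp
    ring
  rw [h1, h2, norm_neg, norm_mul, norm_inv, Complex.norm_natCast, inv_mul_eq_div]
  exact (div_le_div_of_nonneg_right key hm0'.le).trans_lt (hm i j x hx)

/-- Representations of class `Mult(Γ)` of a free group are tempered, also for families of vectors.
By density it suffices to consider vectors that come from multiplicative functions. -/
theorem InMultFree.matrixWeaklyContained {K : Type w} [NormedAddCommGroup K]
    [InnerProductSpace ℂ K] {σ : Γ →* (K ≃ₗᵢ[ℂ] K)} (hσ : InMultFree.{u, v, w} σ)
    (I : Type*) [Finite I] : MatrixWeaklyContained σ (regularRep Γ) I := by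
  obtain ⟨n, b, S, M, J, hM, hJM, hJ⟩ := hσ
  intro ξ Q ε hε
  obtain ⟨μ, hμM, hμ⟩ : ∃ μ : I → K, (∀ i, μ i ∈ M) ∧ ∀ i j, ∀ x ∈ Q,
      ‖inner ℂ (ξ i) (σ x (ξ j)) - inner ℂ (μ i) (σ x (μ j))‖ < ε / 2 := by
    have hD : Dense (Set.pi Set.univ fun _ : I => (M : Set K)) := dense_pi _ fun _ _ => hM
    have hev : ∀ᶠ μ in nhds ξ, ∀ i j, ∀ x ∈ Q,
        ‖inner ℂ (ξ i) (σ x (ξ j)) - inner ℂ (μ i) (σ x (μ j))‖ < ε / 2 := by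
      refine Filter.eventually_all.2 fun i => Filter.eventually_all.2 fun j =>
        (Filter.eventually_all_finset Q).2 fun x _ => ?_
      have hc : Continuous fun μ : I → K =>
          ‖inner ℂ (ξ i) (σ x (ξ j)) - inner ℂ (μ i) (σ x (μ j))‖ := by fun_prop
      refine hc.continuousAt.eventually_lt_const ?_
      simpa using half_pos hε
    obtain ⟨μ, h1, h2⟩ := hD.inter_nhds_nonempty hev
    exact ⟨μ, fun i => h1 i (Set.mem_univ i), h2⟩
  have hφ : ∀ i, ∃ φ : multFun b S, toHSpace b S (HInf.mk b S φ) = J (μ i) := fun i => by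
    obtain ⟨φ, h⟩ : J (μ i) ∈ Set.range (toHSpace b S) := hJM ▸ ⟨μ i, hμM i, rfl⟩
    exact ⟨φ.rep, by rw [HInf.mk_rep, h]⟩
  choose f hf using hφ
  have hcoef : ∀ i j x, inner ℂ (μ i) (σ x (μ j)) = form (f i) (actFun x (f j)) := by
    intro i j x
    rw [← J.inner_map_map, hJ _ (hμM j) x _ (hf j).symm, ← hf i, LinearIsometry.inner_map_map,
      act_mk, HInf.inner_mk]
  obtain ⟨m, η, hη⟩ := exists_lp_of_multFun f Q (half_pos hε)
  refine ⟨m, η, fun i j x hx => ?_⟩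
  have h1 := hμ i j x hx
  have h2 := hη i j x hx
  rw [hcoef] at h1
  have h3 := (norm_add_le _ _).trans_lt (add_lt_add h1 h2)
  rwa [sub_add_sub_cancel, add_halves] at h3

end Free

/-! ### Temperedness of induced representations -/

section Induced

variable {G : Type*} [Group G] {Γ : Subgroup G}

/-- The bijection `(q, γ) ↦ q.out * γ` of `(G ⧸ Γ) × Γ` with `G`. -/
noncomputable def cosetEquiv (Γ : Subgroup G) : (G ⧸ Γ) × Γ ≃ G where
  toFun p := p.1.out * p.2
  invFun g := (g, ⟨(g : G ⧸ Γ).out⁻¹ * g, QuotientGroup.eq.1 (QuotientGroup.out_eq' _)⟩)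
  left_inv := by
    rintro ⟨q, γ⟩
    have hq : ((q.out * γ : G) : G ⧸ Γ) = q := by
      rw [QuotientGroup.mk_mul_of_mem _ γ.2, QuotientGroup.out_eq']
    ext
    · exact hq
    · simp [hq]
  right_inv g := by simp

/-- The cocycle of the left action of `G` on `G ⧸ Γ`: the element `s` of `Γ` for which
`g⁻¹ * q.out = (g⁻¹ • q).out * s`. -/
noncomputable def cosetCocycle (g : G) (q : G ⧸ Γ) : Γ :=
  ⟨(g⁻¹ • q).out⁻¹ * (g⁻¹ * q.out), QuotientGroup.eq.1 <| by
    rw [QuotientGroup.out_eq']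
    conv_lhs => rw [← QuotientGroup.out_eq' q]
    rfl⟩

theorem inv_mul_out (g : G) (q : G ⧸ Γ) :
    g⁻¹ * q.out = (g⁻¹ • q).out * cosetCocycle g q := by
  simp [cosetCocycle]

theorem inv_mul_cosetEquiv (g : G) (q : G ⧸ Γ) (γ : Γ) :
    g⁻¹ * cosetEquiv Γ (q, γ) = cosetEquiv Γ (g⁻¹ • q, cosetCocycle g q * γ) := by
  change g⁻¹ * (q.out * γ) = (g⁻¹ • q).out * (cosetCocycle g q * γ)
  rw [← mul_assoc, inv_mul_out, mul_assoc]

variable [Γ.FiniteIndex]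

attribute [local instance] Subgroup.fintypeQuotientOfFiniteIndex

theorem memlp_cosetGlue (η : G ⧸ Γ → lp (fun _ : Γ => ℂ) 2) :
    Memℓp (fun g => η ((cosetEquiv Γ).symm g).1 ((cosetEquiv Γ).symm g).2 : G → ℂ) 2 := by
  refine memℓp_gen ((cosetEquiv Γ).summable_iff.1 ?_)
  refine (summable_prod_of_nonneg fun _ => Real.rpow_nonneg (norm_nonneg _) _).2 ⟨fun q => ?_, Summable.of_finite⟩
  simpa using (memℓp_gen_iff (p := 2) (by norm_num)).1 (lp.memℓp (η q))

/-- The function on `G` that consists of the functions `η q` on the cosets of `Γ`. -/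
noncomputable def cosetGlue (η : G ⧸ Γ → lp (fun _ : Γ => ℂ) 2) : lp (fun _ : G => ℂ) 2 :=
  ⟨_, memlp_cosetGlue η⟩

theorem cosetGlue_apply (η : G ⧸ Γ → lp (fun _ : Γ => ℂ) 2) (p : (G ⧸ Γ) × Γ) :
    cosetGlue η (cosetEquiv Γ p) = η p.1 p.2 := by
  change η ((cosetEquiv Γ).symm _).1 ((cosetEquiv Γ).symm _).2 = _
  rw [Equiv.symm_apply_apply]

theorem inner_regularRep_cosetGlue (η : G ⧸ Γ → lp (fun _ : Γ => ℂ) 2) (g : G) :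
    inner ℂ (cosetGlue η) (regularRep G g (cosetGlue η))
      = ∑ q, inner ℂ (η q) (regularRep Γ (cosetCocycle g q)⁻¹ (η (g⁻¹ • q))) := by
  have hs := (cosetEquiv Γ).summable_iff.2
    (lp.summable_inner (𝕜 := ℂ) (cosetGlue η) (regularRep G g (cosetGlue η)))
  rw [lp.inner_eq_tsum, ← (cosetEquiv Γ).tsum_eq]
  refine hs.tsum_prod.trans ?_
  rw [tsum_fintype]
  refine Finset.sum_congr rfl fun q _ => ?_
  rw [lp.inner_eq_tsum]
  refine tsum_congr fun γ => ?_
  change inner ℂ (cosetGlue η (cosetEquiv Γ (q, γ))) (cosetGlue η (g⁻¹ * cosetEquiv Γ (q, γ)))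
    = inner ℂ (η q γ) (η (g⁻¹ • q) ((cosetCocycle g q)⁻¹⁻¹ * γ))
  rw [inv_mul_cosetEquiv, cosetGlue_apply, cosetGlue_apply, inv_inv]

variable {K : Type*} [NormedAddCommGroup K] [InnerProductSpace ℂ K]

theorem inner_indRep {σ : Γ →* (K ≃ₗᵢ[ℂ] K)} (f : IndSpace σ) (g : G) :
    inner ℂ f (indRep σ g f)
      = ∑ q : G ⧸ Γ, inner ℂ (f q.out) (σ (cosetCocycle g q)⁻¹ (f (g⁻¹ • q).out)) := by
  rw [IndSpace.inner_def]
  refine Finset.sum_congr rfl fun q _ => ?_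
  change inner ℂ (f q.out) (f (g⁻¹ * q.out)) = _
  rw [f.equivariant, inv_mul_out]
  simp

/-- Induction preserves temperedness: the coefficients of an induced representation are sums of
matrix coefficients, at values of the cocycle, of the representation of the subgroup. -/
theorem weaklyContained_indRep {σ : Γ →* (K ≃ₗᵢ[ℂ] K)}
    (hσ : MatrixWeaklyContained σ (regularRep Γ) (G ⧸ Γ)) :
    WeaklyContained (indRep σ) (regularRep G) := by
  classical
  intro f Q ε hε
  have hc : (0 : ℝ) < Fintype.card (G ⧸ Γ) := by exact_mod_cast Fintype.card_pos
  obtain ⟨n, η, hη⟩ := hσ (fun q => f q.out)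
    ((Q ×ˢ Finset.univ).image fun p : G × (G ⧸ Γ) => (cosetCocycle p.1 p.2)⁻¹)
    (ε / Fintype.card (G ⧸ Γ)) (div_pos hε hc)
  refine ⟨n, fun k => cosetGlue (η k), fun g hg => ?_⟩
  rw [inner_indRep, Finset.sum_congr rfl fun k _ => inner_regularRep_cosetGlue (η k) g,
    Finset.sum_comm, ← Finset.sum_sub_distrib]
  refine (norm_sum_le _ _).trans_lt ?_
  calc _ < ∑ _q : G ⧸ Γ, ε / Fintype.card (G ⧸ Γ) := by
        refine Finset.sum_lt_sum_of_nonempty Finset.univ_nonempty fun q _ => ?_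
        exact hη q (g⁻¹ • q) _ (Finset.mem_image.2 ⟨(g, q), by simp [hg], rfl⟩)
    _ = ε := by
        rw [Finset.sum_const, Finset.card_univ, nsmul_eq_mul, mul_div_cancel₀ _ hc.ne']

end Induced

theorem WeaklyContained.of_isSubrep {G : Type*} [Group G]
    {H : Type*} [NormedAddCommGroup H] [InnerProductSpace ℂ H]
    {K : Type*} [NormedAddCommGroup K] [InnerProductSpace ℂ K]
    {L : Type*} [NormedAddCommGroup L] [InnerProductSpace ℂ L]
    {π : G →* (H ≃ₗᵢ[ℂ] H)} {ρ : G →* (K ≃ₗᵢ[ℂ] K)} {τ : G →* (L ≃ₗᵢ[ℂ] L)}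
    (h : WeaklyContained ρ τ) (hπ : IsSubrep π ρ) : WeaklyContained π τ := by
  obtain ⟨T, hT⟩ := hπ
  intro ξ Q ε hε
  obtain ⟨n, η, hη⟩ := h (T ξ) Q ε hε
  refine ⟨n, η, fun g hg => ?_⟩
  rw [← T.inner_map_map, hT]
  exact hη g hg

theorem InMult.weaklyContained_regularRep {Λ : Type u} [Group Λ]
    {H : Type x} [NormedAddCommGroup H] [InnerProductSpace ℂ H] {π : Λ →* (H ≃ₗᵢ[ℂ] H)}
    (hπ : InMult.{u, v, w} π) : WeaklyContained π (regularRep Λ) := by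
  obtain ⟨Γ, _, _, K, _, _, _, σ, hσ, hsub⟩ := hπ
  exact (weaklyContained_indRep (hσ.matrixWeaklyContained _)).of_isSubrep hsub

end VFree

theorem corollary3p6 {Λ : Type u} [Group Λ] [Group.FG Λ]
    (hΛ : VFree.IsVirtuallyFree Λ)
    {H : Type x} [NormedAddCommGroup H] [InnerProductSpace ℂ H] [CompleteSpace H]
    (π : Λ →* (H ≃ₗᵢ[ℂ] H)) :
    (VFree.InMult.{u, v, w} π → VFree.WeaklyContained π (VFree.regularRep Λ)) ∧
    (VFree.InMultIrr.{u, v, w} π → VFree.WeaklyContained π (VFree.regularRep Λ)) := by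
  refine ⟨fun h => h.weaklyContained_regularRep, fun h => ?_⟩
  obtain ⟨Γ, h1, h2, K, h3, h4, h5, σ, hσ, hsub, -⟩ := h
  exact VFree.InMult.weaklyContained_regularRep ⟨Γ, h1, h2, K, h3, h4, h5, σ, hσ, hsub⟩
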